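/- **Theorem (equivalence of G3 and G3$^{Hist}$).** Formulas are built from propositional variables and the constant $\top$ with $\wedge,\vee,\to,\neg$; $p$ is a propositional variable, $\alpha,\beta,\varphi$ are formulas, $\Gamma$ is a finite multiset of formulas and $\mathcal H$ (the history) is a finite set of formulas. *The calculi* **G3** have the sequents $\Gamma\Rightarrow\varphi$ and (writing premises $\,/\,$ conclusion) the positive rules - (ax) $\;/\;\Gamma,p\Rightarrow p$; $\quad(\top)$ $\;/\;\Gamma\Rightarrow\top$; - $(\to r)$ $\Gamma,\alpha\Rightarrow\beta\;/\;\Gamma\Rightarrow\alpha\to\beta$; $\quad(\to l)$ $\Gamma,\alpha\to\beta\Rightarrow\alpha$ and $\Gamma,\beta\Rightarrow\varphi\;/\;\Gamma,\alpha\to\beta\Rightarrow\varphi$; - $(\wedge r)$ $\Gamma\Rightarrow\alpha$ and $\Gamma\Rightarrow\beta\;/\;\Gamma\Rightarrow\alpha\wedge\beta$; $\quad(\wedge l)$ $\Gamma,\alpha,\beta\Rightarrow\varphi\;/\;\Gamma,\alpha\wedge\beta\Rightarrow\varphi$; - $(\vee r_1)$ $\Gamma\Rightarrow\alpha\;/\;\Gamma\Rightarrow\alpha\vee\beta$;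 $\quad(\vee r_2)$ $\Gamma\Rightarrow\beta\;/\;\Gamma\Rightarrow\alpha\vee\beta$; $\quad(\vee l)$ $\Gamma,\alpha\Rightarrow\varphi$ and $\Gamma,\beta\Rightarrow\varphi\;/\;\Gamma,\alpha\vee\beta\Rightarrow\varphi$; together with a selection of the negation rules - (n) $\Gamma,\neg\alpha,\beta\Rightarrow\alpha$ and $\Gamma,\neg\alpha,\alpha\Rightarrow\beta\;/\;\Gamma,\neg\alpha\Rightarrow\neg\beta$; - (nef) $\Gamma,\neg\alpha\Rightarrow\alpha\;/\;\Gamma,\neg\alpha\Rightarrow\neg\beta$; - (copc) $\Gamma,\neg\alpha,\beta\Rightarrow\alpha\;/\;\Gamma,\neg\alpha\Rightarrow\neg\beta$; - (an) $\Gamma,\alpha\Rightarrow\neg\alpha\;/\;\Gamma\Rightarrow\neg\alpha$. The system **N** has (n); **NeF** has (n) and (nef); **CoPC** has (copc); **MPC** has (copc) and (an). Weakening, contraction and cut are not rules of these calculi. *The calculi* **G3**$^{Hist}$ have the sequents $\mathcal H\mid\Gamma\Rightarrow\varphi$. In the left rules $(\to l)$, $(\wedge l_i)$, $(\vee l)$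 the goal $\varphi$ must be a propositional variable, a negation or a disjunction; $(\varphi,\mathcal H)$ denotes $\mathcal H\cup\{\varphi\}$. The positive rules are - (ax) $\;/\;\mathcal H\mid\Gamma,p\Rightarrow p$; $\quad(\top)$ $\;/\;\mathcal H\mid\Gamma\Rightarrow\top$; - $(\to r_1)$ $\emptyset\mid\Gamma,\alpha\Rightarrow\beta\;/\;\mathcal H\mid\Gamma\Rightarrow\alpha\to\beta$ if $\alpha\notin\Gamma$; $\quad(\to r_2)$ $\mathcal H\mid\Gamma\Rightarrow\beta\;/\;\mathcal H\mid\Gamma\Rightarrow\alpha\to\beta$ if $\alpha\in\Gamma$; - $(\to l)$ $(\varphi,\mathcal H)\mid\Gamma,\alpha\to\beta\Rightarrow\alpha$ and $\emptyset\mid\Gamma,\alpha\to\beta,\beta\Rightarrow\varphi\;/\;\mathcal H\mid\Gamma,\alpha\to\beta\Rightarrow\varphi$ if $\varphi\notin\mathcal H$ and $\beta\notin\Gamma$; - $(\wedge r)$ $\mathcal H\mid\Gamma\Rightarrow\alpha$ and $\mathcal H\mid\Gamma\Rightarrow\beta\;/\;\mathcal H\mid\Gamma\Rightarrow\alpha\wedge\beta$;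 - $(\wedge l_1)$ $\emptyset\mid\Gamma,\alpha\wedge\beta,\alpha\Rightarrow\varphi\;/\;\mathcal H\mid\Gamma,\alpha\wedge\beta\Rightarrow\varphi$ if $\alpha\notin\Gamma$; $\quad(\wedge l_2)$ $\emptyset\mid\Gamma,\alpha\wedge\beta,\beta\Rightarrow\varphi\;/\;\mathcal H\mid\Gamma,\alpha\wedge\beta\Rightarrow\varphi$ if $\beta\notin\Gamma$; - $(\vee r_1)$ $\mathcal H\mid\Gamma\Rightarrow\alpha\;/\;\mathcal H\mid\Gamma\Rightarrow\alpha\vee\beta$; $\quad(\vee r_2)$ $\mathcal H\mid\Gamma\Rightarrow\beta\;/\;\mathcal H\mid\Gamma\Rightarrow\alpha\vee\beta$; - $(\vee l)$ $\emptyset\mid\Gamma,\alpha\vee\beta,\alpha\Rightarrow\varphi$ and $\emptyset\mid\Gamma,\alpha\vee\beta,\beta\Rightarrow\varphi\;/\;\mathcal H\mid\Gamma,\alpha\vee\beta\Rightarrow\varphi$ if $\alpha,\beta\notin\Gamma$; and the negation rules, all with conclusion $\mathcal H\mid\Gamma,\neg\alpha\Rightarrow\neg\beta$ except (an), are - (n$_1$)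 premises $\emptyset\mid\Gamma,\neg\alpha,\beta\Rightarrow\alpha$ and $\emptyset\mid\Gamma,\neg\alpha,\alpha\Rightarrow\beta$, if $\beta\notin\Gamma\cup\{\neg\alpha\}$ and $\alpha\notin\Gamma$; - (n$_2$) premises $\emptyset\mid\Gamma,\neg\alpha,\beta\Rightarrow\alpha$ and $\mathcal H\mid\Gamma,\neg\alpha\Rightarrow\beta$, if $\beta\notin\Gamma\cup\{\neg\alpha\}$ and $\alpha\in\Gamma$; - (n$_3$) premises $(\neg\beta,\mathcal H)\mid\Gamma,\neg\alpha\Rightarrow\alpha$ and $\emptyset\mid\Gamma,\neg\alpha,\alpha\Rightarrow\beta$, if $\neg\beta\notin\mathcal H$, $\beta\in\Gamma\cup\{\neg\alpha\}$ and $\alpha\notin\Gamma$; - (n$_4$) premises $(\neg\beta,\mathcal H)\mid\Gamma,\neg\alpha\Rightarrow\alpha$ and $\mathcal H\mid\Gamma,\neg\alpha\Rightarrow\beta$, if $\neg\beta\notin\mathcal H$, $\beta\in\Gamma\cup\{\neg\alpha\}$ and $\alpha\in\Gamma$; - (nef) premise $(\neg\beta,\mathcal H)\mid\Gamma,\neg\alpha\Rightarrow\alpha$,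 if $\neg\beta\notin\mathcal H$; - (copc$_1$) premise $\emptyset\mid\Gamma,\neg\alpha,\beta\Rightarrow\alpha$, if $\beta\notin\Gamma\cup\{\neg\alpha\}$; - (copc$_2$) premise $(\neg\beta,\mathcal H)\mid\Gamma,\neg\alpha\Rightarrow\alpha$, if $\neg\beta\notin\mathcal H$ and $\beta\in\Gamma\cup\{\neg\alpha\}$; - (an) $\emptyset\mid\Gamma,\alpha\Rightarrow\neg\alpha\;/\;\mathcal H\mid\Gamma\Rightarrow\neg\alpha$ if $\alpha\notin\Gamma$. Here **N** has (n$_1$)–(n$_4$); **NeF** has (n$_1$)–(n$_4$) and (nef); **CoPC** has (copc$_1$), (copc$_2$); **MPC** has (copc$_1$), (copc$_2$) and (an). *Claim.* For each of the four systems **N**, **NeF**, **CoPC**, **MPC**, every finite multiset $\Gamma$ of formulas and every formula $\varphi$: the sequent $\Gamma\Rightarrow\varphi$ is provable in **G3** if and only if $\emptyset\mid\Gamma\Rightarrow\varphi$ is provable in the corresponding **G3**$^{Hist}$. -/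

import Mathlib

namespace WeakNegation

/-- Formulas over a set `Var` of propositional variables: the constant `⊤`, the binary
connectives `∧`, `∨`, `→` and the unary connective `¬`.  There is no constant `⊥`. -/
inductive Formula (Var : Type*) : Type _
  | var : Var → Formula Var
  | top : Formula Var
  | conj : Formula Var → Formula Var → Formula Var
  | disj : Formula Var → Formula Var → Formula Var
  | imp : Formula Var → Formula Var → Formula Var
  | neg : Formula Var → Formula Var
  deriving DecidableEq

/-- The four logical systems: the basic logic `N` of a unary connective, negative ex falso
logic `NeF`, contraposition logic `CoPC`, and minimal logic `MPC`. -/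
inductive System : Type
  | N
  | NeF
  | CoPC
  | MPC

namespace System

/-- The systems whose calculus has the rule (n). -/
def HasN : System → Prop
  | N => True
  | NeF => True
  | CoPC => False
  | MPC => False

/-- The systems whose calculus has the rule (nef). -/
def HasNef : System → Prop
  | N => False
  | NeF => True
  | CoPC => False
  | MPC => False

/-- The systems whose calculus has the rule (copc). -/
def HasCopc : System → Prop
  | N => False
  | NeF => False
  | CoPC => True
  | MPC => True

/-- The systems whose calculus has the rule (an). -/
def HasAn : System → Prop
  | N => False
  | NeF => False
  | CoPC => False
  | MPC => True

end System

open Formula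

/-- `G3 L Γ φ`: the sequent `Γ ⇒ φ`, with `Γ` a finite multiset of formulas, has a derivation
in the calculus **G3** for the system `L` (no structural rules, no cut). -/
inductive G3 {Var : Type*} (L : System) : Multiset (Formula Var) → Formula Var → Prop
  | ax (Γ : Multiset (Formula Var)) (p : Var) : G3 L (var p ::ₘ Γ) (var p)
  | topR (Γ : Multiset (Formula Var)) : G3 L Γ top
  | impR (Γ : Multiset (Formula Var)) (α β : Formula Var) :
      G3 L (α ::ₘ Γ) β → G3 L Γ (imp α β)
  | impL (Γ : Multiset (Formula Var)) (α β φ : Formula Var) :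
      G3 L (imp α β ::ₘ Γ) α → G3 L (β ::ₘ Γ) φ → G3 L (imp α β ::ₘ Γ) φ
  | andR (Γ : Multiset (Formula Var)) (α β : Formula Var) :
      G3 L Γ α → G3 L Γ β → G3 L Γ (conj α β)
  | andL (Γ : Multiset (Formula Var)) (α β φ : Formula Var) :
      G3 L (β ::ₘ α ::ₘ Γ) φ → G3 L (conj α β ::ₘ Γ) φ
  | orR₁ (Γ : Multiset (Formula Var)) (α β : Formula Var) :
      G3 L Γ α → G3 L Γ (disj α β)
  | orR₂ (Γ : Multiset (Formula Var)) (α β : Formula Var) :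
      G3 L Γ β → G3 L Γ (disj α β)
  | orL (Γ : Multiset (Formula Var)) (α β φ : Formula Var) :
      G3 L (α ::ₘ Γ) φ → G3 L (β ::ₘ Γ) φ → G3 L (disj α β ::ₘ Γ) φ
  | n (Γ : Multiset (Formula Var)) (α β : Formula Var) (hL : L.HasN) :
      G3 L (β ::ₘ neg α ::ₘ Γ) α → G3 L (α ::ₘ neg α ::ₘ Γ) β →
        G3 L (neg α ::ₘ Γ) (neg β)
  | nef (Γ : Multiset (Formula Var)) (α β : Formula Var) (hL : L.HasNef) :
      G3 L (neg α ::ₘ Γ) α → G3 L (neg α ::ₘ Γ) (neg β)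
  | copc (Γ : Multiset (Formula Var)) (α β : Formula Var) (hL : L.HasCopc) :
      G3 L (β ::ₘ neg α ::ₘ Γ) α → G3 L (neg α ::ₘ Γ) (neg β)
  | an (Γ : Multiset (Formula Var)) (α : Formula Var) (hL : L.HasAn) :
      G3 L (α ::ₘ Γ) (neg α) → G3 L Γ (neg α)

/-- The goals admitted in the conclusion of a left rule of the history calculus: atoms (that is,
propositional variables), negations and disjunctions. -/
def IsGoal {Var : Type*} : Formula Var → Prop
  | var _ => True
  | top => False
  | conj _ _ => False
  | disj _ _ => True
  | imp _ _ => False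
  | neg _ => True

/-- `G3Hist L H Γ φ`: the history sequent `H | Γ ⇒ φ`, with history a finite set `H` of formulas
and context a finite multiset `Γ` of formulas, has a derivation in the loop-checking calculus
**G3**^Hist for the system `L`. -/
inductive G3Hist {Var : Type*} [DecidableEq Var] (L : System) :
    Finset (Formula Var) → Multiset (Formula Var) → Formula Var → Prop
  | ax (H : Finset (Formula Var)) (Γ : Multiset (Formula Var)) (p : Var) :
      G3Hist L H (var p ::ₘ Γ) (var p)
  | topR (H : Finset (Formula Var)) (Γ : Multiset (Formula Var)) : G3Hist L H Γ top
  | impR₁ (H : Finset (Formula Var)) (Γ : Multiset (Formula Var)) (α β : Formula Var)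
      (hα : α ∉ Γ) :
      G3Hist L ∅ (α ::ₘ Γ) β → G3Hist L H Γ (imp α β)
  | impR₂ (H : Finset (Formula Var)) (Γ : Multiset (Formula Var)) (α β : Formula Var)
      (hα : α ∈ Γ) :
      G3Hist L H Γ β → G3Hist L H Γ (imp α β)
  | impL (H : Finset (Formula Var)) (Γ : Multiset (Formula Var)) (α β φ : Formula Var)
      (hφ : IsGoal φ) (hH : φ ∉ H) (hβ : β ∉ Γ) :
      G3Hist L (insert φ H) (imp α β ::ₘ Γ) α → G3Hist L ∅ (β ::ₘ imp α β ::ₘ Γ) φ →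
        G3Hist L H (imp α β ::ₘ Γ) φ
  | andR (H : Finset (Formula Var)) (Γ : Multiset (Formula Var)) (α β : Formula Var) :
      G3Hist L H Γ α → G3Hist L H Γ β → G3Hist L H Γ (conj α β)
  | andL₁ (H : Finset (Formula Var)) (Γ : Multiset (Formula Var)) (α β φ : Formula Var)
      (hφ : IsGoal φ) (hα : α ∉ Γ) :
      G3Hist L ∅ (α ::ₘ conj α β ::ₘ Γ) φ → G3Hist L H (conj α β ::ₘ Γ) φ
  | andL₂ (H : Finset (Formula Var)) (Γ : Multiset (Formula Var)) (α β φ : Formula Var)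
      (hφ : IsGoal φ) (hβ : β ∉ Γ) :
      G3Hist L ∅ (β ::ₘ conj α β ::ₘ Γ) φ → G3Hist L H (conj α β ::ₘ Γ) φ
  | orR₁ (H : Finset (Formula Var)) (Γ : Multiset (Formula Var)) (α β : Formula Var) :
      G3Hist L H Γ α → G3Hist L H Γ (disj α β)
  | orR₂ (H : Finset (Formula Var)) (Γ : Multiset (Formula Var)) (α β : Formula Var) :
      G3Hist L H Γ β → G3Hist L H Γ (disj α β)
  | orL (H : Finset (Formula Var)) (Γ : Multiset (Formula Var)) (α β φ : Formula Var)
      (hφ : IsGoal φ) (hα : α ∉ Γ) (hβ : β ∉ Γ) :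
      G3Hist L ∅ (α ::ₘ disj α β ::ₘ Γ) φ → G3Hist L ∅ (β ::ₘ disj α β ::ₘ Γ) φ →
        G3Hist L H (disj α β ::ₘ Γ) φ
  | n₁ (H : Finset (Formula Var)) (Γ : Multiset (Formula Var)) (α β : Formula Var)
      (hL : L.HasN) (hβ : β ∉ neg α ::ₘ Γ) (hα : α ∉ Γ) :
      G3Hist L ∅ (β ::ₘ neg α ::ₘ Γ) α → G3Hist L ∅ (α ::ₘ neg α ::ₘ Γ) β →
        G3Hist L H (neg α ::ₘ Γ) (neg β)
  | n₂ (H : Finset (Formula Var)) (Γ : Multiset (Formula Var)) (α β : Formula Var)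
      (hL : L.HasN) (hβ : β ∉ neg α ::ₘ Γ) (hα : α ∈ Γ) :
      G3Hist L ∅ (β ::ₘ neg α ::ₘ Γ) α → G3Hist L H (neg α ::ₘ Γ) β →
        G3Hist L H (neg α ::ₘ Γ) (neg β)
  | n₃ (H : Finset (Formula Var)) (Γ : Multiset (Formula Var)) (α β : Formula Var)
      (hL : L.HasN) (hH : neg β ∉ H) (hβ : β ∈ neg α ::ₘ Γ) (hα : α ∉ Γ) :
      G3Hist L (insert (neg β) H) (neg α ::ₘ Γ) α → G3Hist L ∅ (α ::ₘ neg α ::ₘ Γ) β →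
        G3Hist L H (neg α ::ₘ Γ) (neg β)
  | n₄ (H : Finset (Formula Var)) (Γ : Multiset (Formula Var)) (α β : Formula Var)
      (hL : L.HasN) (hH : neg β ∉ H) (hβ : β ∈ neg α ::ₘ Γ) (hα : α ∈ Γ) :
      G3Hist L (insert (neg β) H) (neg α ::ₘ Γ) α → G3Hist L H (neg α ::ₘ Γ) β →
        G3Hist L H (neg α ::ₘ Γ) (neg β)
  | nef (H : Finset (Formula Var)) (Γ : Multiset (Formula Var)) (α β : Formula Var)
      (hL : L.HasNef) (hH : neg β ∉ H) :
      G3Hist L (insert (neg β) H) (neg α ::ₘ Γ) α → G3Hist L H (neg α ::ₘ Γ) (neg β)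
  | copc₁ (H : Finset (Formula Var)) (Γ : Multiset (Formula Var)) (α β : Formula Var)
      (hL : L.HasCopc) (hβ : β ∉ neg α ::ₘ Γ) :
      G3Hist L ∅ (β ::ₘ neg α ::ₘ Γ) α → G3Hist L H (neg α ::ₘ Γ) (neg β)
  | copc₂ (H : Finset (Formula Var)) (Γ : Multiset (Formula Var)) (α β : Formula Var)
      (hL : L.HasCopc) (hH : neg β ∉ H) (hβ : β ∈ neg α ::ₘ Γ) :
      G3Hist L (insert (neg β) H) (neg α ::ₘ Γ) α → G3Hist L H (neg α ::ₘ Γ) (neg β)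
  | an (H : Finset (Formula Var)) (Γ : Multiset (Formula Var)) (α : Formula Var)
      (hL : L.HasAn) (hα : α ∉ Γ) :
      G3Hist L ∅ (α ::ₘ Γ) (neg α) → G3Hist L H Γ (neg α)

end WeakNegation

/-!
The two directions are proved by comparing both calculi up to the set underlying the context.

From `G3Hist` to `G3` the history is simply forgotten. What remains are the rules of `G3` in a
form that keeps the principal formula, or omits a formula already present; they are admissible
because `G3` admits weakening, inversion of the left rules, and contraction. Contraction
(`G3.contract`) is an induction on the contracted formula, with an induction on the derivation
inside it; a principal `→`, `∧` or `∨` is handled by inversion and contraction of its immediate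
subformulas, so no bound on the height of derivations is needed.

From `G3` to `G3Hist` the argument goes through `CumG3 L n S φ`: derivability with height at most
`n` in a calculus whose contexts are sets, whose rules never discard a formula, and whose left
rules only apply to the goals allowed by `IsGoal`. Every `G3` derivation can be turned into such a
derivation (`G3.cumDerivable`), the restriction on goals being harmless as the right rules for
`→` and `∧` are invertible. Now take a derivation of *minimal* height. A premise with the same
context and the same goal as the conclusion is then impossible, which yields the side conditions
requiring that an added formula be new. The history condition follows from the invariant in
`G3Hist.of_cumG3`: no goal in the history has, over the present context, a derivation as low
as the present one. If a rule that records its goal is applied last in a derivation of minimal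
height `n + 1`, then that goal has no derivation of height `n`, so the invariant persists.
-/

namespace WeakNegation

open Formula

variable {Var : Type*} {L : System}

/-! ### Structural rules of `G3` -/

theorem exists_of_cons_eq_cons {a b : Formula Var} {Γ Δ : Multiset (Formula Var)}
    (hab : a ≠ b) (h : a ::ₘ Γ = b ::ₘ Δ) : ∃ Θ, Γ = b ::ₘ Θ ∧ Δ = a ::ₘ Θ := by
  rcases Multiset.cons_eq_cons.1 h with ⟨h, -⟩ | ⟨-, h⟩
  exacts [absurd h hab, h]

theorem G3.weaken {Γ : Multiset (Formula Var)} {φ : Formula Var} (χ : Formula Var)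
    (h : G3 L Γ φ) : G3 L (χ ::ₘ Γ) φ := by
  induction h with
  | ax Γ p => rw [Multiset.cons_swap]; exact .ax _ p
  | topR Γ => exact .topR _
  | impR Γ α β _ ih => rw [Multiset.cons_swap] at ih; exact .impR _ _ _ ih
  | impL Γ α β φ _ _ ih₁ ih₂ =>
    rw [Multiset.cons_swap] at ih₁ ih₂ ⊢
    exact .impL _ _ _ _ ih₁ ih₂
  | andR Γ α β _ _ ih₁ ih₂ => exact .andR _ _ _ ih₁ ih₂
  | andL Γ α β φ _ ih =>
    rw [Multiset.cons_swap, Multiset.cons_swap χ α] at ih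
    rw [Multiset.cons_swap]
    exact .andL _ _ _ _ ih
  | orR₁ Γ α β _ ih => exact .orR₁ _ _ _ ih
  | orR₂ Γ α β _ ih => exact .orR₂ _ _ _ ih
  | orL Γ α β φ _ _ ih₁ ih₂ =>
    rw [Multiset.cons_swap] at ih₁ ih₂ ⊢
    exact .orL _ _ _ _ ih₁ ih₂
  | n Γ α β hL _ _ ih₁ ih₂ =>
    rw [Multiset.cons_swap, Multiset.cons_swap χ] at ih₁ ih₂
    rw [Multiset.cons_swap]
    exact .n _ _ _ hL ih₁ ih₂
  | nef Γ α β hL _ ih =>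
    rw [Multiset.cons_swap] at ih ⊢
    exact .nef _ _ _ hL ih
  | copc Γ α β hL _ ih =>
    rw [Multiset.cons_swap, Multiset.cons_swap χ] at ih
    rw [Multiset.cons_swap]
    exact .copc _ _ _ hL ih
  | an Γ α hL _ ih => rw [Multiset.cons_swap] at ih; exact .an _ _ hL ih

/-- A formula `χ` in the context that is neither a variable nor a negation may be replaced by the
formulas `Θ`, provided that this is possible where `χ` is principal. All inversion lemmas for the
left rules are instances. -/
theorem G3.replace {χ : Formula Var} {Θ : Multiset (Formula Var)}
    (hvar : ∀ p, var p ≠ χ) (hneg : ∀ α, neg α ≠ χ)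
    (himp : ∀ α β Γ φ, imp α β = χ → G3 L (β ::ₘ Γ) φ → G3 L (Θ + Γ) φ)
    (hconj : ∀ α β Γ φ, conj α β = χ → G3 L (β ::ₘ α ::ₘ Γ) φ → G3 L (Θ + Γ) φ)
    (hdisj : ∀ α β Γ φ, disj α β = χ → G3 L (α ::ₘ Γ) φ → G3 L (β ::ₘ Γ) φ → G3 L (Θ + Γ) φ)
    {Γ : Multiset (Formula Var)} {φ : Formula Var} (h : G3 L (χ ::ₘ Γ) φ) :
    G3 L (Θ + Γ) φ := by
  generalize hΔ : χ ::ₘ Γ = Δ at h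
  induction h generalizing Γ with
  | ax Δ p =>
    obtain ⟨Ξ, rfl, rfl⟩ := exists_of_cons_eq_cons (hvar p).symm hΔ
    rw [Multiset.add_cons]; exact .ax _ p
  | topR => exact .topR _
  | impR Δ α β _ ih =>
    subst hΔ
    have := ih (Multiset.cons_swap _ _ _)
    rw [Multiset.add_cons] at this
    exact .impR _ _ _ this
  | impL Δ α β φ _ h₂ ih₁ ih₂ =>
    by_cases hχ : imp α β = χ
    · subst hχ
      obtain rfl := (Multiset.cons_inj_right _).1 hΔ
      exact himp _ _ _ _ rfl h₂
    · obtain ⟨Ξ, rfl, rfl⟩ := exists_of_cons_eq_cons (Ne.symm hχ) hΔ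
      have h₁ := ih₁ hΔ
      have h₂ := ih₂ (Multiset.cons_swap _ _ _)
      rw [Multiset.add_cons] at h₁ h₂ ⊢
      exact .impL _ _ _ _ h₁ h₂
  | andR Δ α β _ _ ih₁ ih₂ => exact .andR _ _ _ (ih₁ hΔ) (ih₂ hΔ)
  | andL Δ α β φ h ih =>
    by_cases hχ : conj α β = χ
    · subst hχ
      obtain rfl := (Multiset.cons_inj_right _).1 hΔ
      exact hconj _ _ _ _ rfl h
    · obtain ⟨Ξ, rfl, rfl⟩ := exists_of_cons_eq_cons (Ne.symm hχ) hΔ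
      have h := @ih (β ::ₘ α ::ₘ Ξ) (by rw [Multiset.cons_swap, Multiset.cons_swap χ])
      simp only [Multiset.add_cons] at h ⊢
      exact .andL _ _ _ _ h
  | orR₁ Δ α β _ ih => exact .orR₁ _ _ _ (ih hΔ)
  | orR₂ Δ α β _ ih => exact .orR₂ _ _ _ (ih hΔ)
  | orL Δ α β φ h₁ h₂ ih₁ ih₂ =>
    by_cases hχ : disj α β = χ
    · subst hχ
      obtain rfl := (Multiset.cons_inj_right _).1 hΔ
      exact hdisj _ _ _ _ rfl h₁ h₂
    · obtain ⟨Ξ, rfl, rfl⟩ := exists_of_cons_eq_cons (Ne.symm hχ) hΔ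
      have h₁ := ih₁ (Multiset.cons_swap _ _ _)
      have h₂ := ih₂ (Multiset.cons_swap _ _ _)
      rw [Multiset.add_cons] at h₁ h₂ ⊢
      exact .orL _ _ _ _ h₁ h₂
  | n Δ α β hL _ _ ih₁ ih₂ =>
    obtain ⟨Ξ, rfl, rfl⟩ := exists_of_cons_eq_cons (hneg α).symm hΔ
    have h₁ := @ih₁ (β ::ₘ neg α ::ₘ Ξ) (by rw [Multiset.cons_swap, Multiset.cons_swap χ])
    have h₂ := @ih₂ (α ::ₘ neg α ::ₘ Ξ) (by rw [Multiset.cons_swap, Multiset.cons_swap χ])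
    simp only [Multiset.add_cons] at h₁ h₂ ⊢
    exact .n _ _ _ hL h₁ h₂
  | nef Δ α β hL _ ih =>
    obtain ⟨Ξ, rfl, rfl⟩ := exists_of_cons_eq_cons (hneg α).symm hΔ
    have h := ih hΔ
    rw [Multiset.add_cons] at h ⊢
    exact .nef _ _ _ hL h
  | copc Δ α β hL _ ih =>
    obtain ⟨Ξ, rfl, rfl⟩ := exists_of_cons_eq_cons (hneg α).symm hΔ
    have h := @ih (β ::ₘ neg α ::ₘ Ξ) (by rw [Multiset.cons_swap, Multiset.cons_swap χ])
    simp only [Multiset.add_cons] at h ⊢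
    exact .copc _ _ _ hL h
  | an Δ α hL _ ih =>
    subst hΔ
    have := ih (Multiset.cons_swap _ _ _)
    rw [Multiset.add_cons] at this
    exact .an _ _ hL this

theorem G3.invert_imp {α β φ : Formula Var} {Γ : Multiset (Formula Var)}
    (h : G3 L (imp α β ::ₘ Γ) φ) : G3 L (β ::ₘ Γ) φ := by
  rw [← Multiset.singleton_add]
  refine G3.replace (by simp) (by simp) ?_ (by simp) (by simp) h
  rintro _ _ Γ φ ⟨⟩ h
  rwa [Multiset.singleton_add]

theorem G3.invert_conj {α β φ : Formula Var} {Γ : Multiset (Formula Var)}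
    (h : G3 L (conj α β ::ₘ Γ) φ) : G3 L (β ::ₘ α ::ₘ Γ) φ := by
  rw [← Multiset.singleton_add, ← Multiset.singleton_add, ← add_assoc]
  refine G3.replace (by simp) (by simp) (by simp) ?_ (by simp) h
  rintro _ _ Γ φ ⟨⟩ h
  rwa [add_assoc, Multiset.singleton_add, Multiset.singleton_add]

theorem G3.invert_disj {α β φ : Formula Var} {Γ : Multiset (Formula Var)}
    (h : G3 L (disj α β ::ₘ Γ) φ) : G3 L (α ::ₘ Γ) φ ∧ G3 L (β ::ₘ Γ) φ := by
  rw [← Multiset.singleton_add, ← Multiset.singleton_add]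
  constructor <;> refine G3.replace (by simp) (by simp) (by simp) (by simp) ?_ h
  · rintro _ _ Γ φ ⟨⟩ h _
    rwa [Multiset.singleton_add]
  · rintro _ _ Γ φ ⟨⟩ _ h
    rwa [Multiset.singleton_add]

/-- Contraction of `χ` is admissible in `G3` if contraction of its immediate subformulas is, those
of negations excepted: the rules for `¬` keep their principal formula. -/
theorem G3.contract_of_subformulas {χ : Formula Var}
    (himp : ∀ α β, imp α β = χ → ∀ Γ φ, β ∈ Γ → G3 L (β ::ₘ Γ) φ → G3 L Γ φ)
    (hconj : ∀ α β, conj α β = χ → ∀ Γ φ,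
      (α ∈ Γ → G3 L (α ::ₘ Γ) φ → G3 L Γ φ) ∧ (β ∈ Γ → G3 L (β ::ₘ Γ) φ → G3 L Γ φ))
    (hdisj : ∀ α β, disj α β = χ → ∀ Γ φ,
      (α ∈ Γ → G3 L (α ::ₘ Γ) φ → G3 L Γ φ) ∧ (β ∈ Γ → G3 L (β ::ₘ Γ) φ → G3 L Γ φ))
    {Γ : Multiset (Formula Var)} {φ : Formula Var} (hΓ : χ ∈ Γ) (h : G3 L (χ ::ₘ Γ) φ) :
    G3 L Γ φ := by
  generalize hΔ : χ ::ₘ Γ = Δ at h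
  induction h generalizing Γ with
  | ax Δ p =>
    have hp : var p ∈ Γ := by
      by_cases hχ : var p = χ
      · exact hχ ▸ hΓ
      · obtain ⟨Ξ, rfl, rfl⟩ := exists_of_cons_eq_cons (Ne.symm hχ) hΔ
        simp
    obtain ⟨Ξ, rfl⟩ := Multiset.exists_cons_of_mem hp
    exact .ax _ p
  | topR => exact .topR _
  | impR Δ α β _ ih =>
    subst hΔ
    exact .impR _ _ _ (ih (Multiset.mem_cons_of_mem hΓ) (Multiset.cons_swap _ _ _))
  | impL Δ α β φ _ h₂ ih₁ ih₂ =>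
    by_cases hχ : imp α β = χ
    · have h₁ := ih₁ hΓ hΔ
      subst hχ
      obtain rfl := (Multiset.cons_inj_right _).1 hΔ
      obtain ⟨Ξ, rfl⟩ := Multiset.exists_cons_of_mem hΓ
      rw [Multiset.cons_swap] at h₂
      exact .impL _ _ _ _ h₁ (himp _ _ rfl _ _ (by simp) h₂.invert_imp)
    · have h₁ := ih₁ hΓ hΔ
      obtain ⟨Ξ, rfl, rfl⟩ := exists_of_cons_eq_cons (Ne.symm hχ) hΔ
      have hΞ : χ ∈ Ξ := (Multiset.mem_cons.1 hΓ).resolve_left (Ne.symm hχ)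
      exact .impL _ _ _ _ h₁ (ih₂ (Multiset.mem_cons_of_mem hΞ) (Multiset.cons_swap _ _ _))
  | andR Δ α β _ _ ih₁ ih₂ => exact .andR _ _ _ (ih₁ hΓ hΔ) (ih₂ hΓ hΔ)
  | andL Δ α β φ h ih =>
    by_cases hχ : conj α β = χ
    · subst hχ
      obtain rfl := (Multiset.cons_inj_right _).1 hΔ
      obtain ⟨Ξ, rfl⟩ := Multiset.exists_cons_of_mem hΓ
      rw [Multiset.cons_swap α, Multiset.cons_swap β] at h
      have h := h.invert_conj
      have h := (hconj _ _ rfl _ _).2 (by simp) h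
      exact .andL _ _ _ _ ((hconj _ _ rfl _ _).1 (by simp) h)
    · obtain ⟨Ξ, rfl, rfl⟩ := exists_of_cons_eq_cons (Ne.symm hχ) hΔ
      have hΞ : χ ∈ Ξ := (Multiset.mem_cons.1 hΓ).resolve_left (Ne.symm hχ)
      exact .andL _ _ _ _ (ih (by simp [hΞ])
        (by rw [Multiset.cons_swap, Multiset.cons_swap χ]))
  | orR₁ Δ α β _ ih => exact .orR₁ _ _ _ (ih hΓ hΔ)
  | orR₂ Δ α β _ ih => exact .orR₂ _ _ _ (ih hΓ hΔ)
  | orL Δ α β φ h₁ h₂ ih₁ ih₂ =>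
    by_cases hχ : disj α β = χ
    · subst hχ
      obtain rfl := (Multiset.cons_inj_right _).1 hΔ
      obtain ⟨Ξ, rfl⟩ := Multiset.exists_cons_of_mem hΓ
      rw [Multiset.cons_swap] at h₁ h₂
      exact .orL _ _ _ _ ((hdisj _ _ rfl _ _).1 (by simp) h₁.invert_disj.1)
        ((hdisj _ _ rfl _ _).2 (by simp) h₂.invert_disj.2)
    · obtain ⟨Ξ, rfl, rfl⟩ := exists_of_cons_eq_cons (Ne.symm hχ) hΔ
      have hΞ : χ ∈ Ξ := (Multiset.mem_cons.1 hΓ).resolve_left (Ne.symm hχ)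
      exact .orL _ _ _ _ (ih₁ (Multiset.mem_cons_of_mem hΞ) (Multiset.cons_swap _ _ _))
        (ih₂ (Multiset.mem_cons_of_mem hΞ) (Multiset.cons_swap _ _ _))
  | n Δ α β hL _ _ ih₁ ih₂ =>
    have h₁ := @ih₁ (β ::ₘ Γ) (by simp [hΓ]) (by rw [Multiset.cons_swap, hΔ])
    have h₂ := @ih₂ (α ::ₘ Γ) (by simp [hΓ]) (by rw [Multiset.cons_swap, hΔ])
    obtain ⟨Ξ, rfl⟩ := Multiset.exists_cons_of_mem (show neg α ∈ Γ by
      have : neg α ∈ χ ::ₘ Γ := by simp [hΔ]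
      rcases Multiset.mem_cons.1 this with rfl | h
      exacts [hΓ, h])
    exact .n _ _ _ hL h₁ h₂
  | nef Δ α β hL _ ih =>
    have h := ih hΓ hΔ
    obtain ⟨Ξ, rfl⟩ := Multiset.exists_cons_of_mem (show neg α ∈ Γ by
      have : neg α ∈ χ ::ₘ Γ := by simp [hΔ]
      rcases Multiset.mem_cons.1 this with rfl | h
      exacts [hΓ, h])
    exact .nef _ _ _ hL h
  | copc Δ α β hL _ ih =>
    have h := @ih (β ::ₘ Γ) (by simp [hΓ]) (by rw [Multiset.cons_swap, hΔ])
    obtain ⟨Ξ, rfl⟩ := Multiset.exists_cons_of_mem (show neg α ∈ Γ by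
      have : neg α ∈ χ ::ₘ Γ := by simp [hΔ]
      rcases Multiset.mem_cons.1 this with rfl | h
      exacts [hΓ, h])
    exact .copc _ _ _ hL h
  | an Δ α hL _ ih =>
    subst hΔ
    exact .an _ _ hL (ih (Multiset.mem_cons_of_mem hΓ) (Multiset.cons_swap _ _ _))

theorem G3.contract {χ : Formula Var} {Γ : Multiset (Formula Var)} {φ : Formula Var}
    (hΓ : χ ∈ Γ) (h : G3 L (χ ::ₘ Γ) φ) : G3 L Γ φ := by
  induction χ generalizing Γ φ with
  | var | top | neg =>
    exact contract_of_subformulas (by simp) (by simp) (by simp) hΓ h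
  | conj α β ihα ihβ =>
    refine contract_of_subformulas (by simp) ?_ (by simp) hΓ h
    rintro _ _ ⟨⟩ Γ φ
    exact ⟨ihα, ihβ⟩
  | disj α β ihα ihβ =>
    refine contract_of_subformulas (by simp) (by simp) ?_ hΓ h
    rintro _ _ ⟨⟩ Γ φ
    exact ⟨ihα, ihβ⟩
  | imp α β ihα ihβ =>
    refine contract_of_subformulas ?_ (by simp) (by simp) hΓ h
    rintro _ _ ⟨⟩ Γ φ
    exact ihβ

/-! ### Forgetting the history -/

theorem G3Hist.g3 [DecidableEq Var] {H : Finset (Formula Var)} {Γ : Multiset (Formula Var)}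
    {φ : Formula Var} (h : G3Hist L H Γ φ) : G3 L Γ φ := by
  induction h with
  | ax H Γ p => exact .ax _ p
  | topR => exact .topR _
  | impR₁ H Γ α β _ _ ih => exact .impR _ _ _ ih
  | impR₂ H Γ α β _ _ ih => exact .impR _ _ _ (ih.weaken _)
  | impL H Γ α β φ _ _ _ _ _ ih₁ ih₂ =>
    rw [Multiset.cons_swap] at ih₂
    exact .impL _ _ _ _ ih₁ (ih₂.invert_imp.contract (by simp))
  | andR H Γ α β _ _ ih₁ ih₂ => exact .andR _ _ _ ih₁ ih₂
  | andL₁ H Γ α β φ _ _ _ ih =>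
    rw [Multiset.cons_swap] at ih
    have h := ih.invert_conj
    rw [Multiset.cons_swap] at h
    exact .andL _ _ _ _ (h.contract (by simp))
  | andL₂ H Γ α β φ _ _ _ ih =>
    rw [Multiset.cons_swap] at ih
    have h := ih.invert_conj
    rw [Multiset.cons_swap α] at h
    exact .andL _ _ _ _ (h.contract (by simp))
  | orR₁ H Γ α β _ ih => exact .orR₁ _ _ _ ih
  | orR₂ H Γ α β _ ih => exact .orR₂ _ _ _ ih
  | orL H Γ α β φ _ _ _ _ _ ih₁ ih₂ =>
    rw [Multiset.cons_swap] at ih₁ ih₂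
    exact .orL _ _ _ _ (ih₁.invert_disj.1.contract (by simp))
      (ih₂.invert_disj.2.contract (by simp))
  | n₁ H Γ α β hL _ _ _ _ ih₁ ih₂ => exact .n _ _ _ hL ih₁ ih₂
  | n₂ H Γ α β hL _ _ _ _ ih₁ ih₂ => exact .n _ _ _ hL ih₁ (ih₂.weaken _)
  | n₃ H Γ α β hL _ _ _ _ _ ih₁ ih₂ => exact .n _ _ _ hL (ih₁.weaken _) ih₂
  | n₄ H Γ α β hL _ _ _ _ _ ih₁ ih₂ => exact .n _ _ _ hL (ih₁.weaken _) (ih₂.weaken _)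
  | nef H Γ α β hL _ _ ih => exact .nef _ _ _ hL ih
  | copc₁ H Γ α β hL _ _ ih => exact .copc _ _ _ hL ih
  | copc₂ H Γ α β hL _ _ _ ih => exact .copc _ _ _ hL (ih.weaken _)
  | an H Γ α hL _ _ ih => exact .an _ _ hL ih

/-! ### A cumulative calculus with sets as contexts -/

/-- `CumG3 L n S φ`: the sequent `S ⇒ φ`, with `S` a set of formulas, has a derivation of height at
most `n` in the cumulative variant of `G3`, where premises keep all formulas of the conclusion and
the left rules for `→`, `∧`, `∨` are restricted to the goals in `IsGoal`. Axioms are available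
at every `n`, which makes the relation monotone in `n`. -/
inductive CumG3 (L : System) : ℕ → Set (Formula Var) → Formula Var → Prop
  | ax {n S p} : var p ∈ S → CumG3 L n S (var p)
  | topR {n S} : CumG3 L n S top
  | impR {n S α β} : CumG3 L n (insert α S) β → CumG3 L (n + 1) S (imp α β)
  | impL {n S α β φ} : IsGoal φ → imp α β ∈ S → CumG3 L n S α →
      CumG3 L n (insert β S) φ → CumG3 L (n + 1) S φ
  | andR {n S α β} : CumG3 L n S α → CumG3 L n S β → CumG3 L (n + 1) S (conj α β)
  | andL₁ {n S α β φ} : IsGoal φ → conj α β ∈ S → CumG3 L n (insert α S) φ →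
      CumG3 L (n + 1) S φ
  | andL₂ {n S α β φ} : IsGoal φ → conj α β ∈ S → CumG3 L n (insert β S) φ →
      CumG3 L (n + 1) S φ
  | orR₁ {n S α β} : CumG3 L n S α → CumG3 L (n + 1) S (disj α β)
  | orR₂ {n S α β} : CumG3 L n S β → CumG3 L (n + 1) S (disj α β)
  | orL {n S α β φ} : IsGoal φ → disj α β ∈ S → CumG3 L n (insert α S) φ →
      CumG3 L n (insert β S) φ → CumG3 L (n + 1) S φ
  | n {n S α β} : L.HasN → neg α ∈ S → CumG3 L n (insert β S) α →
      CumG3 L n (insert α S) β → CumG3 L (n + 1) S (neg β)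
  | nef {n S α β} : L.HasNef → neg α ∈ S → CumG3 L n S α → CumG3 L (n + 1) S (neg β)
  | copc {n S α β} : L.HasCopc → neg α ∈ S → CumG3 L n (insert β S) α →
      CumG3 L (n + 1) S (neg β)
  | an {n S α} : L.HasAn → CumG3 L n (insert α S) (neg α) → CumG3 L (n + 1) S (neg α)

theorem CumG3.mono {m n : ℕ} {S T : Set (Formula Var)} {φ : Formula Var} (hmn : m ≤ n)
    (hST : S ⊆ T) (h : CumG3 L m S φ) : CumG3 L n T φ := by
  induction h generalizing n T with
  | ax h => exact .ax (hST h)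
  | topR => exact .topR
  | impR _ ih =>
    obtain ⟨n, rfl⟩ := Nat.exists_eq_add_one_of_ne_zero (by omega : n ≠ 0)
    exact .impR (ih (by omega) (Set.insert_subset_insert hST))
  | impL hφ hS _ _ ih₁ ih₂ =>
    obtain ⟨n, rfl⟩ := Nat.exists_eq_add_one_of_ne_zero (by omega : n ≠ 0)
    exact .impL hφ (hST hS) (ih₁ (by omega) hST) (ih₂ (by omega) (Set.insert_subset_insert hST))
  | andR _ _ ih₁ ih₂ =>
    obtain ⟨n, rfl⟩ := Nat.exists_eq_add_one_of_ne_zero (by omega : n ≠ 0)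
    exact .andR (ih₁ (by omega) hST) (ih₂ (by omega) hST)
  | andL₁ hφ hS _ ih =>
    obtain ⟨n, rfl⟩ := Nat.exists_eq_add_one_of_ne_zero (by omega : n ≠ 0)
    exact .andL₁ hφ (hST hS) (ih (by omega) (Set.insert_subset_insert hST))
  | andL₂ hφ hS _ ih =>
    obtain ⟨n, rfl⟩ := Nat.exists_eq_add_one_of_ne_zero (by omega : n ≠ 0)
    exact .andL₂ hφ (hST hS) (ih (by omega) (Set.insert_subset_insert hST))
  | orR₁ _ ih =>
    obtain ⟨n, rfl⟩ := Nat.exists_eq_add_one_of_ne_zero (by omega : n ≠ 0)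
    exact .orR₁ (ih (by omega) hST)
  | orR₂ _ ih =>
    obtain ⟨n, rfl⟩ := Nat.exists_eq_add_one_of_ne_zero (by omega : n ≠ 0)
    exact .orR₂ (ih (by omega) hST)
  | orL hφ hS _ _ ih₁ ih₂ =>
    obtain ⟨n, rfl⟩ := Nat.exists_eq_add_one_of_ne_zero (by omega : n ≠ 0)
    exact .orL hφ (hST hS) (ih₁ (by omega) (Set.insert_subset_insert hST))
      (ih₂ (by omega) (Set.insert_subset_insert hST))
  | n hL hS _ _ ih₁ ih₂ =>
    obtain ⟨n, rfl⟩ := Nat.exists_eq_add_one_of_ne_zero (by omega : n ≠ 0)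
    exact .n hL (hST hS) (ih₁ (by omega) (Set.insert_subset_insert hST))
      (ih₂ (by omega) (Set.insert_subset_insert hST))
  | nef hL hS _ ih =>
    obtain ⟨n, rfl⟩ := Nat.exists_eq_add_one_of_ne_zero (by omega : n ≠ 0)
    exact .nef hL (hST hS) (ih (by omega) hST)
  | copc hL hS _ ih =>
    obtain ⟨n, rfl⟩ := Nat.exists_eq_add_one_of_ne_zero (by omega : n ≠ 0)
    exact .copc hL (hST hS) (ih (by omega) (Set.insert_subset_insert hST))
  | an hL _ ih =>
    obtain ⟨n, rfl⟩ := Nat.exists_eq_add_one_of_ne_zero (by omega : n ≠ 0)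
    exact .an hL (ih (by omega) (Set.insert_subset_insert hST))

/-- Derivability, at some height, in the cumulative calculus. -/
def CumDerivable (L : System) (S : Set (Formula Var)) (φ : Formula Var) : Prop :=
  ∃ n, CumG3 L n S φ

theorem CumDerivable.mono {S T : Set (Formula Var)} {φ : Formula Var} (hST : S ⊆ T)
    (h : CumDerivable L S φ) : CumDerivable L T φ :=
  h.imp fun _ h => h.mono le_rfl hST

/-- Two derivable sequents have derivations of a common height. -/
theorem CumDerivable.common {S T : Set (Formula Var)} {φ ψ : Formula Var}
    (h₁ : CumDerivable L S φ) (h₂ : CumDerivable L T ψ) :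
    ∃ n, CumG3 L n S φ ∧ CumG3 L n T ψ := by
  obtain ⟨m, h₁⟩ := h₁
  obtain ⟨n, h₂⟩ := h₂
  exact ⟨max m n, h₁.mono (le_max_left _ _) subset_rfl, h₂.mono (le_max_right _ _) subset_rfl⟩

/-- A left rule with premises `S, θ₁ ⇒ φ` and `S, θ₂ ⇒ φ` that is available for the goals in
`IsGoal`, over all extensions of `S`, is admissible for every goal: an implication or a conjunction
has to be derived by its right rule, below which the left rule can be moved. -/
theorem CumDerivable.left_of_isGoal {S : Set (Formula Var)} {θ₁ θ₂ : Formula Var}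
    (hrule : ∀ T φ, S ⊆ T → IsGoal φ → CumDerivable L (insert θ₁ T) φ →
      CumDerivable L (insert θ₂ T) φ → CumDerivable L T φ) {φ : Formula Var}
    (h₁ : CumDerivable L (insert θ₁ S) φ) (h₂ : CumDerivable L (insert θ₂ S) φ) :
    CumDerivable L S φ := by
  induction φ generalizing S with
  | var | disj | neg => exact hrule S _ subset_rfl trivial h₁ h₂
  | top => exact ⟨0, .topR⟩
  | conj α β ihα ihβ =>
    obtain ⟨_, h₁⟩ := h₁
    obtain ⟨_, h₂⟩ := h₂
    cases h₁ with
    | impL h | andL₁ h | andL₂ h | orL h => exact h.elim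
    | andR h₁α h₁β =>
    cases h₂ with
    | impL h | andL₁ h | andL₂ h | orL h => exact h.elim
    | andR h₂α h₂β =>
    obtain ⟨n, hα, hβ⟩ := (ihα hrule ⟨_, h₁α⟩ ⟨_, h₂α⟩).common (ihβ hrule ⟨_, h₁β⟩ ⟨_, h₂β⟩)
    exact ⟨_, .andR hα hβ⟩
  | imp α β ihα ihβ =>
    obtain ⟨_, h₁⟩ := h₁
    obtain ⟨_, h₂⟩ := h₂
    cases h₁ with
    | impL h | andL₁ h | andL₂ h | orL h => exact h.elim
    | impR h₁ =>
    cases h₂ with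
    | impL h | andL₁ h | andL₂ h | orL h => exact h.elim
    | impR h₂ =>
    rw [Set.insert_comm] at h₁ h₂
    obtain ⟨n, h⟩ := ihβ (fun T φ hT => hrule T φ ((Set.subset_insert _ _).trans hT))
      ⟨_, h₁⟩ ⟨_, h₂⟩
    exact ⟨_, .impR h⟩

theorem CumDerivable.impL {S : Set (Formula Var)} {α β φ : Formula Var} (hS : imp α β ∈ S)
    (h₁ : CumDerivable L S α) (h₂ : CumDerivable L (insert β S) φ) : CumDerivable L S φ := by
  refine left_of_isGoal (fun T φ hT hφ h _ => ?_) h₂ h₂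
  obtain ⟨n, h₁, h⟩ := (h₁.mono hT).common h
  exact ⟨_, .impL hφ (hT hS) h₁ h⟩

theorem CumDerivable.andL {S : Set (Formula Var)} {α β φ : Formula Var} (hS : conj α β ∈ S)
    (h : CumDerivable L (insert β (insert α S)) φ) : CumDerivable L S φ := by
  have h : CumDerivable L (insert α S) φ :=
    left_of_isGoal (fun T φ hT hφ ⟨_, h⟩ _ => ⟨_, .andL₂ hφ (hT (.inr hS)) h⟩) h h
  exact left_of_isGoal (fun T φ hT hφ ⟨_, h⟩ _ => ⟨_, .andL₁ hφ (hT hS) h⟩) h h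

theorem CumDerivable.orL {S : Set (Formula Var)} {α β φ : Formula Var} (hS : disj α β ∈ S)
    (h₁ : CumDerivable L (insert α S) φ) (h₂ : CumDerivable L (insert β S) φ) :
    CumDerivable L S φ := by
  refine left_of_isGoal (fun T φ hT hφ h₁ h₂ => ?_) h₁ h₂
  obtain ⟨n, h₁, h₂⟩ := h₁.common h₂
  exact ⟨_, .orL hφ (hT hS) h₁ h₂⟩

theorem G3.cumDerivable {Γ : Multiset (Formula Var)} {φ : Formula Var} (h : G3 L Γ φ) :
    CumDerivable L {χ | χ ∈ Γ} φ := by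
  have cons (α : Formula Var) (Γ : Multiset (Formula Var)) :
      {χ | χ ∈ α ::ₘ Γ} = insert α {χ | χ ∈ Γ} := by ext; simp
  induction h with
  | ax Γ p => exact ⟨0, .ax (by simp)⟩
  | topR => exact ⟨0, .topR⟩
  | impR Γ α β _ ih =>
    rw [cons] at ih
    exact ih.elim fun _ h => ⟨_, .impR h⟩
  | impL Γ α β φ _ _ ih₁ ih₂ =>
    refine .impL (α := α) (β := β) (by simp) ih₁ (ih₂.mono fun χ hχ => ?_)
    simp at hχ ⊢; tauto
  | andR Γ α β _ _ ih₁ ih₂ =>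
    obtain ⟨n, h₁, h₂⟩ := ih₁.common ih₂
    exact ⟨_, .andR h₁ h₂⟩
  | andL Γ α β φ _ ih =>
    refine .andL (α := α) (β := β) (by simp) (ih.mono fun χ hχ => ?_)
    simp at hχ ⊢; tauto
  | orR₁ Γ α β _ ih => exact ih.elim fun _ h => ⟨_, .orR₁ h⟩
  | orR₂ Γ α β _ ih => exact ih.elim fun _ h => ⟨_, .orR₂ h⟩
  | orL Γ α β φ _ _ ih₁ ih₂ =>
    refine .orL (α := α) (β := β) (by simp) (ih₁.mono fun χ hχ => ?_) (ih₂.mono fun χ hχ => ?_)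
    all_goals simp at hχ ⊢; tauto
  | n Γ α β hL _ _ ih₁ ih₂ =>
    rw [cons] at ih₁ ih₂
    obtain ⟨n, h₁, h₂⟩ := ih₁.common ih₂
    exact ⟨_, .n hL (by simp) h₁ h₂⟩
  | nef Γ α β hL _ ih => exact ih.elim fun _ h => ⟨_, .nef hL (by simp) h⟩
  | copc Γ α β hL _ ih =>
    rw [cons] at ih
    exact ih.elim fun _ h => ⟨_, .copc hL (by simp) h⟩
  | an Γ α hL _ ih =>
    rw [cons] at ih
    exact ih.elim fun _ h => ⟨_, .an hL h⟩

/-! ### Minimal derivations respect the history -/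

/-- If `S ⇒ φ` has a derivation of height at most `n`, and no `S ⇒ ψ` with `ψ` in the history `H`
has one, then `H | S ⇒ φ` is derivable in the history calculus. -/
theorem G3Hist.of_cumG3 [DecidableEq Var] {n : ℕ} {S : Set (Formula Var)}
    {Γ : Multiset (Formula Var)} {H : Finset (Formula Var)} {φ : Formula Var}
    (hΓ : ∀ χ, χ ∈ S ↔ χ ∈ Γ) (h : CumG3 L n S φ) (hH : ∀ ψ ∈ H, ¬ CumG3 L n S ψ) :
    G3Hist L H Γ φ := by
  induction n using Nat.strong_induction_on generalizing S Γ H φ with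
  | _ n ih =>
  by_cases hmin : ∃ m < n, CumG3 L m S φ
  · obtain ⟨m, hmn, hm⟩ := hmin
    exact ih m hmn hΓ hm fun ψ hψ hm => hH ψ hψ (hm.mono hmn.le subset_rfl)
  have hφH : φ ∉ H := fun hφ => hH φ hφ h
  -- Recursion on a premise with a larger context: the history is reset.
  have new {m : ℕ} {α ψ : Formula Var} (hm : m < n) (h : CumG3 L m (insert α S) ψ) :
      G3Hist L ∅ (α ::ₘ Γ) ψ := ih m hm (by simp [hΓ]) h (by simp)
  -- Recursion on a premise with the same context: the history is kept.
  have keep {m : ℕ} {ψ : Formula Var} (hm : m < n) (h : CumG3 L m S ψ) : G3Hist L H Γ ψ :=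
    ih m hm hΓ h fun χ hχ hS => hH χ hχ (hS.mono hm.le subset_rfl)
  -- By minimality the present goal may even be added to the history.
  have record {m : ℕ} {ψ : Formula Var} (hm : m < n) (h : CumG3 L m S ψ) :
      G3Hist L (insert φ H) Γ ψ := by
    refine ih m hm hΓ h fun χ hχ hS => ?_
    rcases Finset.mem_insert.1 hχ with rfl | hχ
    exacts [hmin ⟨m, hm, hS⟩, hH χ hχ (hS.mono hm.le subset_rfl)]
  -- By minimality a premise with the present goal has a strictly larger context.
  have fresh {m : ℕ} {α : Formula Var} (hm : m < n) (h : CumG3 L m (insert α S) φ) : α ∉ Γ :=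
    fun hα => hmin ⟨m, hm, by rwa [Set.insert_eq_of_mem ((hΓ α).2 hα)] at h⟩
  have same {m : ℕ} {α ψ : Formula Var} (hα : α ∈ Γ) (h : CumG3 L m (insert α S) ψ) :
      CumG3 L m S ψ := by rwa [Set.insert_eq_of_mem ((hΓ α).2 hα)] at h
  cases h with
  | ax hS =>
    obtain ⟨Γ, rfl⟩ := Multiset.exists_cons_of_mem ((hΓ _).1 hS)
    exact .ax _ _ _
  | topR => exact .topR _ _
  | @impR m _ α β h =>
    by_cases hα : α ∈ Γ
    · exact .impR₂ _ _ _ _ hα (keep m.lt_succ_self (same hα h))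
    · exact .impR₁ _ _ _ _ hα (new m.lt_succ_self h)
  | @impL m _ α β _ hφ hS h₁ h₂ =>
    obtain ⟨Γ, rfl⟩ := Multiset.exists_cons_of_mem ((hΓ _).1 hS)
    have hβ := fresh m.lt_succ_self h₂
    exact .impL _ _ _ _ _ hφ hφH (fun h => hβ (Multiset.mem_cons_of_mem h))
      (record m.lt_succ_self h₁) (new m.lt_succ_self h₂)
  | @andR m _ α β h₁ h₂ =>
    exact .andR _ _ _ _ (keep m.lt_succ_self h₁) (keep m.lt_succ_self h₂)
  | @andL₁ m _ α β _ hφ hS h =>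
    obtain ⟨Γ, rfl⟩ := Multiset.exists_cons_of_mem ((hΓ _).1 hS)
    have hα := fresh m.lt_succ_self h
    exact .andL₁ _ _ _ _ _ hφ (fun h => hα (Multiset.mem_cons_of_mem h)) (new m.lt_succ_self h)
  | @andL₂ m _ α β _ hφ hS h =>
    obtain ⟨Γ, rfl⟩ := Multiset.exists_cons_of_mem ((hΓ _).1 hS)
    have hβ := fresh m.lt_succ_self h
    exact .andL₂ _ _ _ _ _ hφ (fun h => hβ (Multiset.mem_cons_of_mem h)) (new m.lt_succ_self h)
  | @orR₁ m _ α β h => exact .orR₁ _ _ _ _ (keep m.lt_succ_self h)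
  | @orR₂ m _ α β h => exact .orR₂ _ _ _ _ (keep m.lt_succ_self h)
  | @orL m _ α β _ hφ hS h₁ h₂ =>
    obtain ⟨Γ, rfl⟩ := Multiset.exists_cons_of_mem ((hΓ _).1 hS)
    have hα := fresh m.lt_succ_self h₁
    have hβ := fresh m.lt_succ_self h₂
    exact .orL _ _ _ _ _ hφ (fun h => hα (Multiset.mem_cons_of_mem h))
      (fun h => hβ (Multiset.mem_cons_of_mem h)) (new m.lt_succ_self h₁) (new m.lt_succ_self h₂)
  | @n m _ α β hL hS h₁ h₂ =>
    obtain ⟨Γ, rfl⟩ := Multiset.exists_cons_of_mem ((hΓ _).1 hS)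
    by_cases hβ : β ∈ neg α ::ₘ Γ <;> by_cases hα : α ∈ Γ
    · exact .n₄ _ _ _ _ hL hφH hβ hα (record m.lt_succ_self (same hβ h₁))
        (keep m.lt_succ_self (same (Multiset.mem_cons_of_mem hα) h₂))
    · exact .n₃ _ _ _ _ hL hφH hβ hα (record m.lt_succ_self (same hβ h₁))
        (new m.lt_succ_self h₂)
    · exact .n₂ _ _ _ _ hL hβ hα (new m.lt_succ_self h₁)
        (keep m.lt_succ_self (same (Multiset.mem_cons_of_mem hα) h₂))
    · exact .n₁ _ _ _ _ hL hβ hα (new m.lt_succ_self h₁) (new m.lt_succ_self h₂)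
  | @nef m _ α β hL hS h =>
    obtain ⟨Γ, rfl⟩ := Multiset.exists_cons_of_mem ((hΓ _).1 hS)
    exact .nef _ _ _ _ hL hφH (record m.lt_succ_self h)
  | @copc m _ α β hL hS h =>
    obtain ⟨Γ, rfl⟩ := Multiset.exists_cons_of_mem ((hΓ _).1 hS)
    by_cases hβ : β ∈ neg α ::ₘ Γ
    · exact .copc₂ _ _ _ _ hL hφH hβ (record m.lt_succ_self (same hβ h))
    · exact .copc₁ _ _ _ _ hL hβ (new m.lt_succ_self h)
  | @an m _ α hL h =>
    exact .an _ _ _ hL (fresh m.lt_succ_self h) (new m.lt_succ_self h)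

end WeakNegation

theorem theorem5p4 {Var : Type*} [DecidableEq Var] (L : WeakNegation.System)
    (Γ : Multiset (WeakNegation.Formula Var)) (φ : WeakNegation.Formula Var) :
    WeakNegation.G3 L Γ φ ↔ WeakNegation.G3Hist L ∅ Γ φ := by
  refine ⟨fun h => ?_, fun h => h.g3⟩
  obtain ⟨n, h⟩ := h.cumDerivable
  exact .of_cumG3 (fun _ => Iff.rfl) h (by simp)
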